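/- Let $k$ be a commutative unitary ring and $\lambda,\kappa\in k$. A linear operator $P$ on a $k$-algebra $R$ is an *extended Rota-Baxter operator of weight $(\lambda,\kappa)$* if $P(x)P(y)=P(xP(y))+P(P(x)y)+\lambda P(xy)+\kappa xy$ for all $x,y\in R$. For a commutative $k$-algebra $A$, let $Ш_e(A)=\bigoplus_{n\ge1}A^{\otimes n}$, let $P_A$ be the operator $\mathfrak a\mapsto 1_A\otimes\mathfrak a$, and let $\diamond$ be the bilinear product given on pure tensors by $a_0\diamond b_0=a_0b_0$, $a_0\diamond(b_0\otimes\mathfrak b')=a_0b_0\otimes\mathfrak b'$, $(a_0\otimes\mathfrak a')\diamond b_0=a_0b_0\otimes\mathfrak a'$ and $$(a_0\otimes\mathfrak a')\diamond(b_0\otimes\mathfrak b')=a_0b_0\otimes\big(\mathfrak a'\diamond(1_A\otimes\mathfrak b')+(1_A\otimes\mathfrak a')\diamond\mathfrak b'+\lambda\,\mathfrak a'\diamond\mathfrak b'\big)+\kappa\,a_0b_0(\mathfrak a'\diamond\mathfrak b'),$$ where $A$ acts on the first tensor factor; this is the free commutative algebra with an extended Rota-Baxter operator of weight $(\lambda,\kappa)$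 on $A$. Let $\mu\in k$ satisfy $\mu^2-\lambda\mu+\kappa=0$, and let $A$ be a commutative bialgebra with comultiplication $\Delta_A$ and counit $\varepsilon_A$. Let $\varepsilon:Ш_e(A)\to k$ be the unique algebra homomorphism with $\varepsilon|_A=\varepsilon_A$ and $\varepsilon\circ P_A=-\mu\,\varepsilon$. Let $\bar P$ be the linear operator on $Ш_e(A)\,\bar\otimes\,Ш_e(A)$ (where $\bar\otimes$ is the tensor product over $k$) with $$\bar P(\mathfrak a\,\bar\otimes\,\mathfrak b)=P_A(\mathfrak a)\,\bar\otimes\,\varepsilon(\mathfrak b)1_A+\mu\,\mathfrak a\,\bar\otimes\,\varepsilon(\mathfrak b)1_A+\mathfrak a\,\bar\otimes\,P_A(\mathfrak b),$$ and let $\Delta:Ш_e(A)\to Ш_e(A)\,\bar\otimes\,Ш_e(A)$ be the unique algebra homomorphism with $\Delta|_A=\Delta_A$ and $\Delta\circ P_A=\bar P\circ\Delta$. Take $A=k$ with its standard bialgebra structure ($\Delta_k(x)=x\otimes 1$, $\varepsilon_k=\mathrm{id}$), and let $\mathbf 1^{\otimes n}\in k^{\otimes n}\subset Ш_e(k)$.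 Then $$\Delta(\mathbf 1^{\otimes(m+1)})=\sum_{i=0}^{m}\mathbf 1^{\otimes(i+1)}\,\bar\otimes\,\mathbf 1^{\otimes(m+1-i)}+\mu\sum_{i=0}^{m-1}\mathbf 1^{\otimes(i+1)}\,\bar\otimes\,\mathbf 1^{\otimes(m-i)}\qquad\text{for all integers }m\ge1,$$ and $\varepsilon(\mathbf 1^{\otimes(m+1)})=(-\mu)^m$ for all integers $m\ge0$. -/

import Mathlib

open scoped TensorProduct DirectSum

noncomputable section

namespace ExtendedRB

universe u v w

/-- A linear operator `P` on a `k`-algebra `R` is an extended Rota-Baxter operator of weight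
`(lam, kap)` if `P(x)P(y) = P(xP(y)) + P(P(x)y) + lam P(xy) + kap xy` for all `x, y`. -/
def IsExtRBOperator {k : Type u} [CommRing k] (lam kap : k) {R : Type v} [Ring R] [Algebra k R]
    (P : R →ₗ[k] R) : Prop :=
  ∀ x y : R, P x * P y = P (x * P y) + P (P x * y) + lam • P (x * y) + kap • (x * y)

section TensorPowers

variable {k : Type u} [CommRing k] {A : Type v} [CommRing A] [Algebra k A]

/-- `a ⊗ (a₁ ⊗ ⋯ ⊗ aₙ) ↦ a ⊗ a₁ ⊗ ⋯ ⊗ aₙ`. -/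
def consT (n : ℕ) : A →ₗ[k] (⨂[k]^n A) →ₗ[k] (⨂[k]^(n + 1) A) :=
  (PiTensorProduct.lift (R := k) (s := fun _ : Fin n => A)
      (E := ⨂[k]^(n + 1) A)).toLinearMap ∘ₗ
    (PiTensorProduct.tprod k (s := fun _ : Fin (n + 1) => A)).curryLeft

/-- The linear map on `A^{⊗(n+1)}` induced by a bilinear map on `A × A^{⊗n}`. -/
def unconsT (n : ℕ) {M : Type w} [AddCommGroup M] [Module k M]
    (f : A →ₗ[k] (⨂[k]^n A) →ₗ[k] M) : (⨂[k]^(n + 1) A) →ₗ[k] M :=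
  PiTensorProduct.lift (LinearMap.uncurryLeft (M := fun _ : Fin (n + 1) => A)
    ((PiTensorProduct.lift (R := k) (s := fun _ : Fin n => A) (E := M)).symm.toLinearMap ∘ₗ f))

theorem consT_tprod (n : ℕ) (a : A) (v : Fin n → A) :
    consT (k := k) n a (PiTensorProduct.tprod k v) =
      PiTensorProduct.tprod k (Fin.cons a v : Fin (n + 1) → A) := by
  simp [consT]

theorem unconsT_consT (n : ℕ) {M : Type w} [AddCommGroup M] [Module k M]
    (f : A →ₗ[k] (⨂[k]^n A) →ₗ[k] M) (a : A) (t : ⨂[k]^n A) :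
    unconsT n f (consT n a t) = f a t := by
  have : unconsT n f ∘ₗ consT n a = f a := by
    ext v
    simp [consT_tprod, unconsT]
  exact LinearMap.congr_fun this t

theorem consT_induction {n : ℕ} {p : (⨂[k]^(n + 1) A) → Prop} (t : ⨂[k]^(n + 1) A)
    (cons : ∀ a t, p (consT n a t)) (add : ∀ x y, p x → p y → p (x + y)) : p t := by
  refine PiTensorProduct.induction_on t (fun r v => ?_) add
  rw [← Fin.cons_self_tail v, ← consT_tprod, ← map_smul]
  exact cons _ _

/-- `a ↦ a` as an element of `A^{⊗1}`. -/
def oneT : A →ₗ[k] (⨂[k]^1 A) :=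
  (PiTensorProduct.subsingletonEquiv (R := k) (s := fun _ : Fin 1 => A)
    (0 : Fin 1)).symm.toLinearMap

/-- The identification `A^{⊗1} = A`. -/
def unoneT : (⨂[k]^1 A) →ₗ[k] A :=
  (PiTensorProduct.subsingletonEquiv (R := k) (s := fun _ : Fin 1 => A) (0 : Fin 1)).toLinearMap

theorem unoneT_oneT (a : A) : unoneT (k := k) (oneT a) = a := by
  simp [unoneT, oneT]

theorem oneT_unoneT (t : ⨂[k]^1 A) : oneT (unoneT t) = t := by
  simp [unoneT, oneT]

theorem oneT_eq (a : A) : oneT (k := k) a = PiTensorProduct.tprod k (fun _ => a) := by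
  rw [← oneT_unoneT (PiTensorProduct.tprod k (fun _ => a))]
  simp [unoneT]

/-- For bilinear `C` and `D`, the bilinear map sending `(a₀ ⊗ a', b₀ ⊗ b')` to
`C (a₀ b₀) (D a' b')`. -/
def pairT {m n : ℕ} {S : Type w} [AddCommGroup S] [Module k S] (C : A →ₗ[k] S →ₗ[k] S)
    (D : (⨂[k]^m A) →ₗ[k] (⨂[k]^n A) →ₗ[k] S) :
    (⨂[k]^(m + 1) A) →ₗ[k] (⨂[k]^(n + 1) A) →ₗ[k] S :=
  LinearMap.flip <| unconsT n <| LinearMap.mk₂ k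
    (fun b₀ b' => unconsT m <| LinearMap.mk₂ k (fun a₀ a' => C (a₀ * b₀) (D a' b'))
      (by intros; simp [add_mul]) (by intros; simp)
      (by intros; simp) (by intros; simp))
    (by
      intros; refine LinearMap.ext fun x => ?_; induction x using consT_induction with
      | cons a t => simp [unconsT_consT, mul_add]
      | add x y hx hy => rw [map_add, hx, hy, map_add])
    (by
      intros; refine LinearMap.ext fun x => ?_; induction x using consT_induction with
      | cons a t => simp [unconsT_consT]
      | add x y hx hy => rw [map_add, hx, hy, map_add])
    (by
      intros; refine LinearMap.ext fun x => ?_; induction x using consT_induction with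
      | cons a t => simp [unconsT_consT]
      | add x y hx hy => rw [map_add, hx, hy, map_add])
    (by
      intros; refine LinearMap.ext fun x => ?_; induction x using consT_induction with
      | cons a t => simp [unconsT_consT]
      | add x y hx hy => rw [map_add, hx, hy, map_add])

theorem pairT_consT {m n : ℕ} {S : Type w} [AddCommGroup S] [Module k S]
    (C : A →ₗ[k] S →ₗ[k] S) (D : (⨂[k]^m A) →ₗ[k] (⨂[k]^n A) →ₗ[k] S) (a b : A)
    (s : ⨂[k]^m A) (t : ⨂[k]^n A) :
    pairT C D (consT m a s) (consT n b t) = C (a * b) (D s t) := by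
  simp [pairT, unconsT_consT]

/-- `(a, b₀ ⊗ b₁ ⊗ ⋯ ⊗ bₙ) ↦ a b₀ ⊗ b₁ ⊗ ⋯ ⊗ bₙ`. -/
def actT (n : ℕ) : A →ₗ[k] (⨂[k]^(n + 1) A) →ₗ[k] (⨂[k]^(n + 1) A) :=
  LinearMap.mk₂ k (fun a => unconsT n (consT n ∘ₗ LinearMap.mul k A a))
    (by
      intro a b x; induction x using consT_induction with
      | cons c t => simp [unconsT_consT]
      | add x y hx hy => rw [map_add, hx, hy, map_add, map_add]; abel)
    (by
      intro a b x; induction x using consT_induction with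
      | cons c t => simp [unconsT_consT]
      | add x y hx hy => rw [map_add, hx, hy, map_add, smul_add])
    (by intros; rw [map_add]) (by intros; rw [map_smul])

theorem actT_consT (n : ℕ) (a b : A) (t : ⨂[k]^n A) :
    actT n a (consT n b t) = consT n (a * b) t := by
  simp [actT, unconsT_consT]

end TensorPowers

/-- The `k`-module `A ⊕ A^{⊗2} ⊕ ⋯`; the summand of index `n` is `A^{⊗(n+1)}`. The weight
`(lam, kap)` is recorded because the product depends on it. -/
def Sha {k : Type u} [CommRing k] (_lam _kap : k) (A : Type v) [CommRing A] [Algebra k A] :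
    Type (max u v) :=
  ⨁ n : ℕ, ⨂[k]^(n + 1) A

namespace Sha

variable {k : Type u} [CommRing k] {lam kap : k} {A : Type v} [CommRing A] [Algebra k A]

instance : AddCommGroup (Sha lam kap A) :=
  inferInstanceAs (AddCommGroup (⨁ n : ℕ, ⨂[k]^(n + 1) A))

instance : Module k (Sha lam kap A) :=
  inferInstanceAs (Module k (⨁ n : ℕ, ⨂[k]^(n + 1) A))

/-- The inclusion of `A^{⊗(n+1)}`. -/
def of (n : ℕ) : (⨂[k]^(n + 1) A) →ₗ[k] Sha lam kap A :=
  DirectSum.lof k ℕ (fun n : ℕ => ⨂[k]^(n + 1) A) n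

/-- The linear map given by its restrictions to the summands `A^{⊗(n+1)}`. -/
def desc {M : Type w} [AddCommGroup M] [Module k M] (f : ∀ n : ℕ, (⨂[k]^(n + 1) A) →ₗ[k] M) :
    Sha lam kap A →ₗ[k] M :=
  DirectSum.toModule k ℕ M f

@[simp]
theorem desc_of {M : Type w} [AddCommGroup M] [Module k M]
    (f : ∀ n : ℕ, (⨂[k]^(n + 1) A) →ₗ[k] M) (n : ℕ) (t : ⨂[k]^(n + 1) A) :
    desc f (of (lam := lam) (kap := kap) n t) = f n t := by
  exact DirectSum.toModule_lof (ι := ℕ) (M := fun n : ℕ => ⨂[k]^(n + 1) A) (φ := f) k n t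

theorem of_induction {p : Sha lam kap A → Prop} (x : Sha lam kap A)
    (of : ∀ n t, p (of n t)) (add : ∀ x y, p x → p y → p (x + y)) : p x := by
  refine DirectSum.induction_on (motive := p) x ?_ of add
  have := of 0 0
  rw [map_zero] at this
  exact this

/-- The natural embedding `A → Sha`, as a linear map. -/
def incl : A →ₗ[k] Sha lam kap A := of 0 ∘ₗ oneT

/-- `(a, x) ↦ a ⊗ x`. -/
def cons : A →ₗ[k] Sha lam kap A →ₗ[k] Sha lam kap A :=
  LinearMap.flip (desc fun n => LinearMap.flip ((consT (n + 1)).compr₂ (of (n + 1))))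

/-- The right shift operator `x ↦ 1 ⊗ x`. -/
def shift : Sha lam kap A →ₗ[k] Sha lam kap A := cons 1

/-- `(a, b₀ ⊗ b₁ ⊗ ⋯ ⊗ bₙ) ↦ a b₀ ⊗ b₁ ⊗ ⋯ ⊗ bₙ`. -/
def act : A →ₗ[k] Sha lam kap A →ₗ[k] Sha lam kap A :=
  LinearMap.flip (desc fun n => LinearMap.flip ((actT n).compr₂ (of n)))

theorem cons_of (a : A) (n : ℕ) (t : ⨂[k]^(n + 1) A) :
    cons a (of (lam := lam) (kap := kap) n t) = of (n + 1) (consT (n + 1) a t) := by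
  simp [cons]

/-- The product on pure tensors: with `a = a₀ ⊗ a'` and `b = b₀ ⊗ b'`,
* `a₀ * b = a₀b₀ ⊗ b'` and `a * b₀ = a₀b₀ ⊗ a'`;
* `a * b = a₀b₀ ⊗ (a' * (1 ⊗ b') + (1 ⊗ a') * b' + lam (a' * b')) + kap a₀b₀ (a' * b')`. -/
def mulAux : ∀ m n : ℕ,
    (⨂[k]^(m + 1) A) →ₗ[k] (⨂[k]^(n + 1) A) →ₗ[k] Sha lam kap A
  | 0, n => (act ∘ₗ unoneT).compl₂ (of n)
  | m + 1, 0 => LinearMap.flip ((act ∘ₗ unoneT).compl₂ (of (m + 1)))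
  | m + 1, n + 1 =>
      pairT cons ((mulAux m (n + 1)).compl₂ (consT (n + 1) 1) +
          mulAux (m + 1) n ∘ₗ consT (m + 1) 1 + lam • mulAux m n) +
        kap • pairT act (mulAux m n)
termination_by m n => m + n

/-- The bilinear extension of the product to `Sha`. -/
def mul : Sha lam kap A →ₗ[k] Sha lam kap A →ₗ[k] Sha lam kap A :=
  desc fun m => LinearMap.flip (desc fun n => LinearMap.flip (mulAux m n))

theorem mul_of (m n : ℕ) (s : ⨂[k]^(m + 1) A) (t : ⨂[k]^(n + 1) A) :
    mul (of (lam := lam) (kap := kap) m s) (of n t) = mulAux m n s t := by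
  simp [mul]

theorem induction {p : Sha lam kap A → Prop} (x : Sha lam kap A)
    (incl : ∀ a, p (incl a)) (cons : ∀ a x, p x → p (cons a x))
    (add : ∀ x y, p x → p y → p (x + y)) : p x := by
  refine of_induction x (fun n => ?_) add
  induction n with
  | zero => intro t; rw [← oneT_unoneT t]; exact incl _
  | succ n ih =>
    intro t
    induction t using consT_induction with
    | cons a t => rw [← cons_of]; exact cons _ _ (ih t)
    | add x y hx hy => rw [map_add]; exact add _ _ hx hy

theorem act_incl (a b : A) : act a (incl (lam := lam) (kap := kap) b) = incl (k := k) (a * b) := by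
  have h (c : A) : oneT (k := k) c = consT 0 c (PiTensorProduct.tprod k Fin.elim0) := by
    rw [oneT_eq, consT_tprod]; congr 1; ext i; fin_cases i; rfl
  simp [act, incl, h, actT_consT]

theorem act_cons (a b : A) (x : Sha lam kap A) : act a (cons b x) = cons (a * b) x := by
  induction x using of_induction with
  | of n t => simp [cons_of, act, actT_consT]
  | add x y hx hy => simp only [map_add, hx, hy]

theorem act_act (a b : A) (x : Sha lam kap A) : act a (act b x) = act (a * b) x := by
  induction x using induction with
  | incl c => simp only [act_incl, mul_assoc]
  | cons c x _ => simp only [act_cons, mul_assoc]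
  | add x y hx hy => simp only [map_add, hx, hy]

theorem act_one (x : Sha lam kap A) : act 1 x = x := by
  induction x using induction with
  | incl c => simp only [act_incl, one_mul]
  | cons c x _ => simp only [act_cons, one_mul]
  | add x y hx hy => simp only [map_add, hx, hy]

theorem incl_mul' (a : A) (x : Sha lam kap A) : mul (incl a) x = act a x := by
  induction x using of_induction with
  | of n t => simp [incl, mul_of, mulAux, unoneT_oneT]
  | add x y hx hy => simp only [map_add, hx, hy]

theorem mul_incl' (x : Sha lam kap A) (a : A) : mul x (incl a) = act a x := by
  induction x using induction with
  | incl b => simp only [incl_mul', act_incl, mul_comm]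
  | cons b x ih =>
    clear ih
    induction x using of_induction with
    | of n t => simp [incl, cons_of, mul_of, mulAux, unoneT_oneT]
    | add x y hx hy => simp only [map_add, LinearMap.add_apply, hx, hy]
  | add x y hx hy => simp only [map_add, LinearMap.add_apply, hx, hy]

theorem cons_mul_cons' (a b : A) (x y : Sha lam kap A) :
    mul (cons a x) (cons b y) =
      cons (a * b) (mul x (shift y) + mul (shift x) y + lam • mul x y) +
        kap • act (a * b) (mul x y) := by
  induction x using of_induction with
  | of m s =>
    induction y using of_induction with
    | of n t =>
      simp only [cons_of, mul_of, shift]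
      rw [mulAux]
      simp [pairT_consT]
    | add x y hx hy => simp only [map_add, hx, hy, smul_add]; abel
  | add x y hx hy => simp only [map_add, LinearMap.add_apply, hx, hy, smul_add]; abel

theorem act_shift (a : A) (x : Sha lam kap A) : act a (shift x) = cons a x := by
  rw [shift, act_cons, mul_one]

theorem act_mul' (a : A) (x y : Sha lam kap A) : mul (act a x) y = act a (mul x y) := by
  induction x using induction with
  | incl b => simp only [act_incl, incl_mul', act_act]
  | cons b x ih =>
    clear ih
    induction y using induction with
    | incl c => simp only [mul_incl', act_act, mul_comm]
    | cons c y _ =>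
      simp only [act_cons, cons_mul_cons', map_add, map_smul, act_act, mul_assoc]
    | add x y hx hy => simp only [map_add, hx, hy]
  | add x y hx hy => simp only [map_add, LinearMap.add_apply, hx, hy]

theorem mul_act' (a : A) (x y : Sha lam kap A) : mul x (act a y) = act a (mul x y) := by
  induction y using induction with
  | incl b => simp only [act_incl, mul_incl', act_act]
  | cons b y ih =>
    clear ih
    induction x using induction with
    | incl c => simp only [incl_mul', act_act, mul_comm]
    | cons c x _ =>
      simp only [act_cons, cons_mul_cons', map_add, map_smul, act_act, mul_left_comm]
    | add x y hx hy => simp only [map_add, LinearMap.add_apply, hx, hy]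
  | add x y hx hy => simp only [map_add, hx, hy]

theorem shift_mul_shift' (x y : Sha lam kap A) :
    mul (shift x) (shift y) =
      shift (mul x (shift y)) + shift (mul (shift x) y) + lam • shift (mul x y) +
        kap • mul x y := by
  rw [shift, cons_mul_cons', ← shift, mul_one, act_one]
  simp [shift]

/-- `IsPure n x`: `x` is a pure tensor with `n + 1` factors. -/
inductive IsPure : ℕ → Sha lam kap A → Prop
  | incl (a : A) : IsPure 0 (incl a)
  | cons (a : A) {n : ℕ} {x : Sha lam kap A} : IsPure n x → IsPure (n + 1) (cons a x)

theorem IsPure.shift {n : ℕ} {x : Sha lam kap A} (h : IsPure n x) : IsPure (n + 1) (shift x) :=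
  h.cons 1

theorem pure_induction {p : Sha lam kap A → Prop} (x : Sha lam kap A)
    (pure : ∀ n x, IsPure n x → p x) (add : ∀ x y, p x → p y → p (x + y)) : p x := by
  have key : ∃ s : Multiset (Sha lam kap A), (∀ y ∈ s, ∃ n, IsPure n y) ∧ s.sum = x := by
    induction x using induction with
    | incl a => exact ⟨{incl a}, by simpa using ⟨0, IsPure.incl a⟩, by simp⟩
    | cons a x h =>
      obtain ⟨s, hs, rfl⟩ := h
      refine ⟨s.map (cons a), ?_, by rw [map_multiset_sum]⟩
      intro y hy
      obtain ⟨z, hz, rfl⟩ := Multiset.mem_map.1 hy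
      obtain ⟨n, hn⟩ := hs z hz
      exact ⟨n + 1, hn.cons a⟩
    | add x y hx hy =>
      obtain ⟨s, hs, rfl⟩ := hx
      obtain ⟨t, ht, rfl⟩ := hy
      refine ⟨s + t, ?_, by simp⟩
      intro z hz
      rcases Multiset.mem_add.1 hz with h | h
      exacts [hs z h, ht z h]
  obtain ⟨s, hs, rfl⟩ := key
  induction s using Multiset.induction with
  | empty => simpa using pure 0 _ (IsPure.incl 0)
  | cons a s ih =>
    rw [Multiset.sum_cons]
    obtain ⟨n, hn⟩ := hs a (Multiset.mem_cons_self a s)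
    exact add _ _ (pure n _ hn) (ih fun y hy => hs y (Multiset.mem_cons_of_mem hy))

theorem mul_comm_pure (N : ℕ) : ∀ (m n : ℕ) (x y : Sha lam kap A), IsPure m x → IsPure n y →
    m + n < N → mul x y = mul y x := by
  induction N with
  | zero => intros; omega
  | succ N ih =>
    rintro _ _ _ _ (a | ⟨a, hx⟩) hy hN
    · rw [incl_mul', mul_incl']
    · rcases hy with (b | ⟨b, hy⟩)
      · rw [incl_mul', mul_incl']
      · rw [cons_mul_cons', cons_mul_cons', ih _ _ _ _ hx hy.shift (by omega),
          ih _ _ _ _ hx.shift hy (by omega), ih _ _ _ _ hx hy (by omega), mul_comm a b]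
        simp only [map_add]
        abel

theorem mul_comm' (x y : Sha lam kap A) : mul x y = mul y x := by
  induction x using pure_induction with
  | pure m x hx =>
    induction y using pure_induction with
    | pure n y hy => exact mul_comm_pure _ m n x y hx hy (Nat.lt_succ_self _)
    | add x y hx hy => simp only [map_add, LinearMap.add_apply, hx, hy]
  | add x y hx hy => simp only [map_add, LinearMap.add_apply, hx, hy]

theorem mul_assoc_pure (N : ℕ) : ∀ (m n l : ℕ) (x y z : Sha lam kap A), IsPure m x →
    IsPure n y → IsPure l z → m + n + l < N → mul (mul x y) z = mul x (mul y z) := by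
  induction N with
  | zero => intros; omega
  | succ N ih =>
    rintro _ _ _ _ _ _ (a | @⟨a, m, x, hx⟩) hy hz hN
    · rw [incl_mul', incl_mul', act_mul']
    rcases hy with (b | @⟨b, n, y, hy⟩)
    · rw [incl_mul', mul_incl', act_mul', mul_act']
    rcases hz with (c | @⟨c, l, z, hz⟩)
    · rw [mul_incl', mul_incl', mul_act']
    rw [← act_shift a, ← act_shift b, ← act_shift c]
    simp only [act_mul', mul_act']
    congr 3
    have h1 := congrArg shift (ih _ _ _ _ _ _ hx hy.shift hz.shift (by omega))
    have h2 := congrArg shift (ih _ _ _ _ _ _ hx.shift hy hz.shift (by omega))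
    have h3 := congrArg shift (ih _ _ _ _ _ _ hx.shift hy.shift hz (by omega))
    have h4 := ih _ _ _ _ _ _ hx hy hz.shift (by omega)
    have h5 := ih _ _ _ _ _ _ hx hy.shift hz (by omega)
    have h6 := ih _ _ _ _ _ _ hx.shift hy hz (by omega)
    have h7 := congrArg shift (ih _ _ _ _ _ _ hx hy hz (by omega))
    have h7' := ih _ _ _ _ _ _ hx hy hz (by omega)
    have h4' := congrArg shift h4
    have h5' := congrArg shift h5
    have h6' := congrArg shift h6
    simp only [shift_mul_shift', map_add, map_smul, LinearMap.add_apply, LinearMap.smul_apply]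
      at h1 h2 h3 h4 h5 h6 h7 h7' h4' h5' h6' ⊢
    linear_combination (norm := module) h1 + h2 + h3 + lam • h4' + lam • h5' + lam • h6' +
      (lam ^ 2 - kap) • h7 + kap • h4 + kap • h5 + kap • h6 + (lam * kap) • h7'

theorem mul_assoc' (x y z : Sha lam kap A) : mul (mul x y) z = mul x (mul y z) := by
  induction x using pure_induction with
  | pure m x hx =>
    induction y using pure_induction with
    | pure n y hy =>
      induction z using pure_induction with
      | pure l z hz => exact mul_assoc_pure _ m n l x y z hx hy hz (Nat.lt_succ_self _)
      | add x y hx hy => simp only [map_add, hx, hy]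
    | add x y hx hy => simp only [map_add, LinearMap.add_apply, hx, hy]
  | add x y hx hy => simp only [map_add, LinearMap.add_apply, hx, hy]

instance : Mul (Sha lam kap A) := ⟨fun x y => mul x y⟩

instance : One (Sha lam kap A) := ⟨incl 1⟩

theorem mul_def (x y : Sha lam kap A) : x * y = mul x y := rfl

theorem one_def : (1 : Sha lam kap A) = incl 1 := rfl

instance : CommRing (Sha lam kap A) where
  __ := (inferInstance : AddCommGroup (Sha lam kap A))
  mul_assoc := mul_assoc'
  mul_comm := mul_comm'
  one_mul x := by rw [mul_def, one_def, incl_mul', act_one]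
  mul_one x := by rw [mul_def, one_def, mul_incl', act_one]
  left_distrib x y z := by simp only [mul_def, map_add]
  right_distrib x y z := by simp only [mul_def, map_add, LinearMap.add_apply]
  zero_mul x := by simp only [mul_def, map_zero, LinearMap.zero_apply]
  mul_zero x := by simp only [mul_def, map_zero]

instance : Algebra k (Sha lam kap A) :=
  Algebra.ofModule (fun r x y => by simp only [mul_def, map_smul, LinearMap.smul_apply])
    (fun r x y => by simp only [mul_def, map_smul])

/-- The natural embedding `A → Sha`, as an algebra homomorphism. -/
def inclHom : A →ₐ[k] Sha lam kap A :=
  AlgHom.ofLinearMap incl rfl fun a b => by rw [mul_def, incl_mul', act_incl]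

theorem shift_isExtRBOperator : IsExtRBOperator lam kap (shift (lam := lam) (kap := kap) (A := A)) :=
  shift_mul_shift'

theorem cons_eq (a : A) (x : Sha lam kap A) : cons a x = inclHom a * shift x := by
  rw [← act_shift, ← incl_mul']; rfl

/-- The restriction to `A^{⊗(n+1)}` of the homomorphism induced by `f`:
`a₀ ↦ f(a₀)` and `a₀ ⊗ a' ↦ f(a₀) Q(F(a'))`. -/
def liftAux {R : Type w} [CommRing R] [Algebra k R] (Q : R →ₗ[k] R) (f : A →ₐ[k] R) :
    ∀ n : ℕ, (⨂[k]^(n + 1) A) →ₗ[k] R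
  | 0 => f.toLinearMap ∘ₗ unoneT
  | n + 1 => unconsT (n + 1) ((LinearMap.mul k R ∘ₗ f.toLinearMap).compl₂ (Q ∘ₗ liftAux Q f n))

/-- The universal property of `Sha`. -/
theorem existsUnique_lift {R : Type w} [CommRing R] [Algebra k R] (Q : R →ₗ[k] R)
    (hQ : IsExtRBOperator lam kap Q) (f : A →ₐ[k] R) :
    ∃! F : Sha lam kap A →ₐ[k] R, (∀ a, F (inclHom a) = f a) ∧ ∀ x, F (shift x) = Q (F x) := by
  let F : Sha lam kap A →ₗ[k] R := desc (liftAux Q f)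
  have hF1 (a : A) : F (incl a) = f a := by simp [F, incl, liftAux, unoneT_oneT]
  have hF2 (a : A) (x : Sha lam kap A) : F (cons a x) = f a * Q (F x) := by
    induction x using of_induction with
    | of n t => simp [F, cons_of, liftAux, unconsT_consT]
    | add x y hx hy => simp only [map_add, hx, hy, mul_add]
  have hF3 (x : Sha lam kap A) : F (shift x) = Q (F x) := by
    rw [shift, hF2, map_one, one_mul]
  have hF4 (a : A) (x : Sha lam kap A) : F (act a x) = f a * F x := by
    induction x using induction with
    | incl b => rw [act_incl, hF1, hF1, map_mul]
    | cons b x _ => rw [act_cons, hF2, hF2, map_mul, mul_assoc]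
    | add x y hx hy => simp only [map_add, hx, hy, mul_add]
  have hF5 (N : ℕ) : ∀ (m n : ℕ) (x y : Sha lam kap A), IsPure m x → IsPure n y →
      m + n < N → F (mul x y) = F x * F y := by
    induction N with
    | zero => intros; omega
    | succ N ih =>
      rintro _ _ _ _ (a | ⟨a, hx⟩) hy hN
      · rw [incl_mul', hF4, hF1]
      · rcases hy with (b | ⟨b, hy⟩)
        · rw [mul_incl', hF4, hF1, mul_comm]
        · rw [cons_mul_cons', map_add, hF2, map_smul, hF4, hF2, hF2, mul_mul_mul_comm, hQ,
            map_mul]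
          simp only [map_add, map_smul, ih _ _ _ _ hx hy.shift (by omega),
            ih _ _ _ _ hx.shift hy (by omega), ih _ _ _ _ hx hy (by omega), hF3, mul_add,
            mul_smul_comm]
  have hF6 (x y : Sha lam kap A) : F (x * y) = F x * F y := by
    rw [mul_def]
    induction x using pure_induction with
    | pure m x hx =>
      induction y using pure_induction with
      | pure n y hy => exact hF5 _ m n x y hx hy (Nat.lt_succ_self _)
      | add x y hx hy => simp only [map_add, hx, hy, mul_add]
    | add x y hx hy => simp only [map_add, LinearMap.add_apply, hx, hy, add_mul]
  refine ⟨AlgHom.ofLinearMap F (by rw [one_def, hF1, map_one]) hF6, ⟨hF1, hF3⟩, ?_⟩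
  rintro G ⟨hG1, hG2⟩
  ext x
  change G x = F x
  induction x using induction with
  | incl a => rw [hF1]; exact hG1 a
  | cons a x h => rw [hF2, cons_eq, map_mul, hG1, hG2, h]
  | add x y hx hy => rw [map_add, map_add, hx, hy]

/-- The unique algebra homomorphism `F : Sha → R` with `F ∘ inclHom = f` and
`F ∘ shift = Q ∘ F`. -/
def lift {R : Type w} [CommRing R] [Algebra k R] (Q : R →ₗ[k] R)
    (hQ : IsExtRBOperator lam kap Q) (f : A →ₐ[k] R) : Sha lam kap A →ₐ[k] R :=
  (existsUnique_lift Q hQ f).choose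

theorem lift_incl {R : Type w} [CommRing R] [Algebra k R] (Q : R →ₗ[k] R)
    (hQ : IsExtRBOperator lam kap Q) (f : A →ₐ[k] R) (a : A) :
    lift Q hQ f (inclHom a) = f a :=
  (existsUnique_lift Q hQ f).choose_spec.1.1 a

theorem lift_shift {R : Type w} [CommRing R] [Algebra k R] (Q : R →ₗ[k] R)
    (hQ : IsExtRBOperator lam kap Q) (f : A →ₐ[k] R) (x : Sha lam kap A) :
    lift Q hQ f (shift x) = Q (lift Q hQ f x) :=
  (existsUnique_lift Q hQ f).choose_spec.1.2 x

section Bialgebra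

variable {k : Type u} [CommRing k] {lam kap mu : k} {A : Type v} [CommRing A] [Bialgebra k A]

theorem neg_smul_isExtRBOperator (hmu : mu ^ 2 - lam * mu + kap = 0) :
    IsExtRBOperator lam kap ((-mu) • (LinearMap.id : k →ₗ[k] k)) := by
  intro x y
  simp only [LinearMap.smul_apply, LinearMap.id_apply, smul_eq_mul]
  linear_combination (-(x * y)) * hmu

/-- The counit of `Sha`: the unique algebra homomorphism `ε : Sha → k` that restricts to the
counit of `A` and satisfies `ε ∘ shift = -mu ε`. -/
def counit (hmu : mu ^ 2 - lam * mu + kap = 0) : Sha lam kap A →ₐ[k] k :=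
  lift ((-mu) • LinearMap.id) (neg_smul_isExtRBOperator hmu) (Bialgebra.counitAlgHom k A)

/-- The linear operator on `Sha ⊗ Sha` with
`a ⊗ b ↦ shift a ⊗ ε(b) 1 + mu a ⊗ ε(b) 1 + a ⊗ shift b`. -/
def barP (hmu : mu ^ 2 - lam * mu + kap = 0) :
    (Sha lam kap A ⊗[k] Sha lam kap A) →ₗ[k] (Sha lam kap A ⊗[k] Sha lam kap A) :=
  let e : Sha lam kap A →ₗ[k] Sha lam kap A :=
    Algebra.linearMap k (Sha lam kap A) ∘ₗ (counit hmu).toLinearMap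
  TensorProduct.map shift e + mu • TensorProduct.map LinearMap.id e +
    TensorProduct.map LinearMap.id shift

theorem barP_tmul (hmu : mu ^ 2 - lam * mu + kap = 0) (a b : Sha lam kap A) :
    barP hmu (a ⊗ₜ[k] b) = counit hmu b • (shift a ⊗ₜ[k] (1 : Sha lam kap A)) +
      (mu * counit hmu b) • (a ⊗ₜ[k] (1 : Sha lam kap A)) + a ⊗ₜ[k] shift b := by
  simp [barP, Algebra.algebraMap_eq_smul_one, smul_smul]

theorem barP_isExtRBOperator (hmu : mu ^ 2 - lam * mu + kap = 0) :
    IsExtRBOperator lam kap (barP (A := A) hmu) := by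
  have hs (b : Sha lam kap A) : counit hmu (shift b) = -mu * counit hmu b := by
    rw [counit, lift_shift]; simp
  intro x y
  induction x using TensorProduct.induction_on with
  | zero => simp
  | add x x' hx hx' => simp only [map_add, add_mul, hx, hx', smul_add]; abel
  | tmul a b =>
    induction y using TensorProduct.induction_on with
    | zero => simp
    | add x x' hx hx' => simp only [map_add, mul_add, hx, hx', smul_add]; abel
    | tmul c d =>
      obtain rfl : kap = lam * mu - mu ^ 2 := by linear_combination hmu
      simp only [barP_tmul, mul_add, add_mul, smul_mul_assoc, mul_smul_comm,
        Algebra.TensorProduct.tmul_mul_tmul, mul_one, one_mul, map_add, map_smul, map_mul, hs,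
        shift_isExtRBOperator a c, shift_isExtRBOperator b d, TensorProduct.add_tmul,
        TensorProduct.tmul_add, ← TensorProduct.smul_tmul', TensorProduct.tmul_smul]
      module

/-- The comultiplication of `Sha`: the unique algebra homomorphism `Δ : Sha → Sha ⊗ Sha` that
restricts to the comultiplication of `A` and satisfies `Δ ∘ shift = barP ∘ Δ`. -/
def comul (hmu : mu ^ 2 - lam * mu + kap = 0) :
    Sha lam kap A →ₐ[k] (Sha lam kap A ⊗[k] Sha lam kap A) :=
  lift (barP hmu) (barP_isExtRBOperator hmu)
    ((Algebra.TensorProduct.map inclHom inclHom).comp (Bialgebra.comulAlgHom k A))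

end Bialgebra

/-- `1^{⊗(n+1)}`, in the summand `A^{⊗(n+1)}`. -/
def onePow {k : Type u} [CommRing k] {lam kap : k} {A : Type v} [CommRing A] [Algebra k A]
    (n : ℕ) : Sha lam kap A :=
  of n (PiTensorProduct.tprod k fun _ => 1)

end Sha

end ExtendedRB

end

namespace ExtendedRB.Sha

/-! ### Powers of the shift on the unit -/

section OnePow

variable {k : Type*} [CommRing k] {lam kap : k} {A : Type*} [CommRing A] [Algebra k A]

/-! Write `u_n` for `onePow n`. Then `u_0 = 1` and `u_{n+1} = shift u_n`, so the values of `counit`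
and `comul` on every `u_n` follow from their values at `1` and their relations with `shift`. No
product in `Sha` has to be expanded, and the coefficient algebra enters only through its unit. The
counit is multiplied by `-mu` at each step.

For the comultiplication, put `S_n = ∑_{i ≤ n} u_i ⊗ u_{n-i}`. The counit values turn the first two
terms of `barP (u_i ⊗ u_{n-i})` into consecutive differences of `(-mu)^(n+1-i) u_i ⊗ 1`, while the
third is `u_i ⊗ u_{n+1-i}`. Summing over `i` gives `barP S_n = S_{n+1} - (-mu)^(n+1) (1 ⊗ 1)`
(`barP_sum_onePow`). In `barP (S_n + mu S_{n-1})` the two multiples of `1 ⊗ 1` are opposite, which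
leaves `S_{n+1} + mu S_n`; this is the induction step of `comul_onePow`. -/

theorem onePow_zero : onePow 0 = (1 : Sha lam kap A) := by
  rw [one_def, incl, LinearMap.comp_apply, oneT_eq, onePow]

/-- Prepending `1` to a constant family of ones gives a constant family again. This turns the
relations of `counit` and `comul` with `shift` into recursions in `n`. -/
theorem shift_onePow (n : ℕ) :
    shift (onePow n : Sha lam kap A) = onePow (n + 1) := by
  rw [onePow, onePow, shift, cons_of, consT_tprod]
  congr 2
  ext i
  refine Fin.cases ?_ (fun j => ?_) i <;> simp

end OnePow

/-! ### Counit and comultiplication on these powers -/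

section Bialgebra

variable {k : Type*} [CommRing k] {lam kap mu : k} {A : Type*} [CommRing A] [Bialgebra k A]

theorem counit_shift (hmu : mu ^ 2 - lam * mu + kap = 0) (x : Sha lam kap A) :
    counit hmu (shift x) = -mu * counit hmu x :=
  lift_shift _ _ _ _

theorem counit_onePow (hmu : mu ^ 2 - lam * mu + kap = 0) (n : ℕ) :
    counit (A := A) hmu (onePow n) = (-mu) ^ n := by
  induction n with
  | zero => rw [onePow_zero, map_one, pow_zero]
  | succ n ih =>
    rw [← shift_onePow, counit_shift, ih, pow_succ']

theorem comul_shift (hmu : mu ^ 2 - lam * mu + kap = 0) (x : Sha lam kap A) :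
    comul hmu (shift x) = barP hmu (comul hmu x) :=
  lift_shift _ _ _ _

/-- The operator `barP` almost maps `∑ 1^{⊗(i+1)} ⊗ 1^{⊗(n+1-i)}` to the next such sum: the other
terms telescope to a multiple of `1 ⊗ 1`. -/
theorem barP_sum_onePow (hmu : mu ^ 2 - lam * mu + kap = 0) (n : ℕ) :
    barP (A := A) hmu (∑ i ∈ Finset.range (n + 1), onePow i ⊗ₜ[k] onePow (n - i)) =
      ∑ i ∈ Finset.range (n + 2), onePow i ⊗ₜ[k] onePow (n + 1 - i) -
        (-mu) ^ (n + 1) • (1 : Sha lam kap A ⊗[k] Sha lam kap A) := by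
  -- With `g i = (-mu)^(n+1-i) u_i ⊗ 1`, the bracket is `g (i+1) - g i`; the unsimplified exponent
  -- `n + 1 - (i + 1)` keeps it in the shape that `Finset.sum_range_sub` expects.
  have key : ∀ i ∈ Finset.range (n + 1),
      barP (A := A) hmu (onePow i ⊗ₜ[k] onePow (n - i)) =
        ((-mu) ^ (n + 1 - (i + 1)) • (onePow (i + 1) ⊗ₜ[k] (1 : Sha lam kap A)) -
          (-mu) ^ (n + 1 - i) • (onePow i ⊗ₜ[k] (1 : Sha lam kap A))) +
        onePow i ⊗ₜ[k] onePow (n + 1 - i) := by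
    intro i hi
    have h : n + 1 - i = n - i + 1 := Nat.succ_sub (Finset.mem_range_succ_iff.1 hi)
    rw [barP_tmul, counit_onePow, shift_onePow, shift_onePow, h, Nat.add_sub_add_right, pow_succ']
    module
  -- Of the telescoped sum, `g (n+1) = u_{n+1} ⊗ 1` supplies the missing last term of the next sum,
  -- and `g 0` is the multiple of `1 ⊗ 1` left over.
  rw [map_sum, Finset.sum_congr rfl key, Finset.sum_add_distrib,
    Finset.sum_range_sub (fun i => (-mu) ^ (n + 1 - i) • (onePow i ⊗ₜ[k] (1 : Sha lam kap A))),
    Finset.sum_range_succ _ (n + 1), Nat.sub_self, Nat.sub_zero, pow_zero, one_smul, onePow_zero,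
    Algebra.TensorProduct.one_def]
  abel

/-- The correction `mu S_{n-1}` is what cancels the defect of `barP` on `S_n`. The induction can
start at `n = 0`, where the second sum is empty and the truncated `n - 1` is harmless. -/
theorem comul_onePow (hmu : mu ^ 2 - lam * mu + kap = 0) (n : ℕ) :
    comul (A := A) hmu (onePow n) =
      ∑ i ∈ Finset.range (n + 1), onePow i ⊗ₜ[k] onePow (n - i) +
        mu • ∑ i ∈ Finset.range n, onePow i ⊗ₜ[k] onePow (n - 1 - i) := by
  induction n with
  | zero => simp [onePow_zero, Algebra.TensorProduct.one_def]
  | succ n ih =>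
    rw [← shift_onePow, comul_shift, ih, map_add, map_smul, barP_sum_onePow, Nat.add_sub_cancel]
    -- The second sum is a genuine `S_{n-1}` only for positive `n`. From `0` to `1` it is empty, and
    -- the uncancelled defect `-(-mu) (1 ⊗ 1)` itself becomes the new term `mu S_0`.
    cases n with
    | zero =>
      simp [onePow_zero, Algebra.TensorProduct.one_def]
    | succ n =>
      -- Factoring `(-mu)^(n+2)` as `-mu * (-mu)^(n+1)` lets `module` cancel the two defects.
      rw [Nat.add_sub_cancel, barP_sum_onePow, pow_succ' _ (n + 1)]
      module

end Bialgebra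

end ExtendedRB.Sha

theorem mainTheorem8 {k : Type*} [CommRing k] (lam kap mu : k)
    (hmu : mu ^ 2 - lam * mu + kap = 0) :
    (∀ n : ℕ, 1 ≤ n →
      ExtendedRB.Sha.comul (A := k) hmu (ExtendedRB.Sha.onePow n) =
        ∑ i ∈ Finset.range (n + 1),
            ExtendedRB.Sha.onePow i ⊗ₜ[k] ExtendedRB.Sha.onePow (n - i) +
          mu • ∑ i ∈ Finset.range n,
            ExtendedRB.Sha.onePow i ⊗ₜ[k] ExtendedRB.Sha.onePow (n - 1 - i)) ∧
    ∀ n : ℕ, ExtendedRB.Sha.counit (A := k) hmu (ExtendedRB.Sha.onePow n) = (-mu) ^ n := by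
  exact ⟨fun n _ => ExtendedRB.Sha.comul_onePow hmu n, ExtendedRB.Sha.counit_onePow hmu⟩
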